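/- Let $\mathcal Q\subset\mathbb R^2$ be a convex polygon, $o$ a known fixed point in its interior (the target), and $\varphi_o(p)=(p-o)/\|p-o\|$ the radial map from $\partial\mathcal Q$ to the unit circle $\mathbb T$. Let $\omega_{\max}>0$, $\Delta t>0$ and $\sigma\ge 0$. Let $N$ robots start at pairwise distinct points of $\partial\mathcal Q$. Then $\varphi_o$ is a bijection $\partial\mathcal Q\to\mathbb T$, and the robots can be numbered counterclockwise, with $\varphi_o$-images of angles $\theta_1<\theta_2<\dots<\theta_N<\theta_1+2\pi$. Fix such a numbering and put $\theta_{0}=\theta_N-2\pi$, $\theta_{N+1}=\theta_1+2\pi$. Each robot $i$ knows its own angle $\theta_i$ and stores values $\theta^i_{i-1},\theta^i_{i+1}$ for the angles of its neighbours, collected $\tau^i\geq 0$ time units ago. Initially the stored data are any correct data, $|\theta_{i\pm1}-\theta^i_{i\pm1}|\le\omega_{\max}\tau^i$ (for example exact data with $\tau^i=0$). Put $$gV^i=\tfrac14\left(\theta^i_{i+1}+2\theta_i+\theta^i_{i-1}\right),\qquad \mathrm{ubd}_i=\tfrac12\omega_{\max}\tau^i,\qquad u_i=\omega_i\,\mathrm{sgn}(gV^i-\theta_i),$$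 where $\omega_i=\omega_{\max}$ if $|gV^i-\theta_i|\ge \mathrm{ubd}_i+\omega_{\max}\Delta t$, $\omega_i=0$ if $|gV^i-\theta_i|\le\mathrm{ubd}_i$, and $\omega_i=(|gV^i-\theta_i|-\mathrm{ubd}_i)/\Delta t$ otherwise. The Self-triggered Midpoint algorithm does the following at each time $t_k=k\Delta t$, $k=0,1,2,\dots$, for all robots simultaneously. Robot $i$ increments $\tau^i$ by $\Delta t$ and computes $gV^i$, $\mathrm{ubd}_i$, $u_i$ and $\theta_i'=\theta_i+u_i\Delta t$. If one of the conditions $$\mathrm{ubd}_i<\max\{|\theta_i'-gV^i|,\sigma\},\qquad \theta^i_{i+1}-\omega_{\max}\tau^i>\theta_i>\theta^i_{i-1}+\omega_{\max}\tau^i$$ fails, it replaces $\theta^i_{i\pm1}$ by the present angles $\theta_{i\pm1}(t_k)$, resets $\tau^i$ to $0$, and recomputes $gV^i$, $\mathrm{ubd}_i$, $u_i$. Then it moves with constant angular velocity $u_i$ during $[t_k,t_{k+1}]$. Then the team converges to a uniform configuration: there are angles $\theta_1^*,\dots,\theta_N^*$ with $\theta^*_{i+1}-\theta^*_i=2\pi/N$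 for all $i$ (where $\theta^*_{N+1}=\theta^*_1+2\pi$) such that, for every $i$, $\theta_i(t)\to\theta_i^*$ as $t\to\infty$, and the position $\varphi_o^{-1}(e^{\mathrm i\theta_i(t)})$ of robot $i$ on $\partial\mathcal Q$ converges to $\varphi_o^{-1}(e^{\mathrm i\theta_i^*})$. -/

import Mathlib

noncomputable section

namespace SelfTriggered

/-- The plane is `ℂ`. The radial map `p ↦ (p - o) / ‖p - o‖` from the boundary of the environment
to the unit circle around the target `o`. -/
def radialMap (o p : ℂ) : ℂ := (p - o) / ((‖p - o‖ : ℝ) : ℂ)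

/-- The convex polygon spanned by a finite set of points. -/
def polygon (V : Finset ℂ) : Set ℂ := convexHull ℝ (V : Set ℂ)

/-- The inverse of the radial map: the point of `∂Q` that is seen from `o` in direction
`exp (i θ)`. -/
def boundaryPoint (Q : Set ℂ) (o : ℂ) (θ : ℝ) : ℂ :=
  Function.invFunOn (radialMap o) (frontier Q) (Complex.exp (θ * Complex.I))

/-- The angle of the counterclockwise neighbour `i + 1` of robot `i`. Angles are real lifts of
points of the circle; the neighbour of the last robot is the first one, one turn further. -/
def nextAngle {N : ℕ} (θ : Fin N → ℝ) (i : Fin N) : ℝ :=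
  if h : (i : ℕ) + 1 < N then θ ⟨(i : ℕ) + 1, h⟩
  else θ ⟨0, Nat.lt_of_le_of_lt (Nat.zero_le _) i.isLt⟩ + 2 * Real.pi

/-- The angle of the clockwise neighbour `i - 1` of robot `i`, with the same convention. -/
def prevAngle {N : ℕ} (θ : Fin N → ℝ) (i : Fin N) : ℝ :=
  if (i : ℕ) = 0 then
    θ ⟨N - 1, Nat.sub_lt (Nat.lt_of_le_of_lt (Nat.zero_le _) i.isLt) Nat.one_pos⟩ - 2 * Real.pi
  else θ ⟨(i : ℕ) - 1, Nat.lt_of_le_of_lt (Nat.sub_le _ _) i.isLt⟩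

/-- The robots at `p` are numbered in counterclockwise order as seen from `o`, and `θ` are their
angles: `θ₁ < θ₂ < ⋯ < θ_N < θ₁ + 2π`. -/
structure IsCounterclockwise {N : ℕ} (o : ℂ) (p : Fin N → ℂ) (θ : Fin N → ℝ) : Prop where
  lift : ∀ i, radialMap o (p i) = Complex.exp (θ i * Complex.I)
  strictMono : StrictMono θ
  oneTurn : ∀ i j, θ i < θ j + 2 * Real.pi

/-- Neighbouring robots are `2π / N` apart. -/
def IsUniform {N : ℕ} (θ : Fin N → ℝ) : Prop :=
  ∀ i, nextAngle θ i - θ i = 2 * Real.pi / N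

/-- What robot `i` knows: its own angle, the last known angles of its neighbours `i - 1` and
`i + 1`, and the time elapsed since these were collected (both are always collected together). -/
structure RobotState where
  pos : ℝ
  prev : ℝ
  next : ℝ
  tau : ℝ

/-- Lower end of the guaranteed Voronoi segment: halfway between the robot and the furthest
counterclockwise position that robot `i - 1` can have reached. -/
def gvsLower (ω : ℝ) (r : RobotState) : ℝ := ((r.prev + ω * r.tau) + r.pos) / 2

/-- Upper end of the guaranteed Voronoi segment: halfway between the robot and the furthest
clockwise position that robot `i + 1` can have reached. -/
def gvsUpper (ω : ℝ) (r : RobotState) : ℝ := (r.pos + (r.next - ω * r.tau)) / 2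

/-- Midpoint of the guaranteed Voronoi segment. -/
def gvMid (ω : ℝ) (r : RobotState) : ℝ := (gvsUpper ω r + gvsLower ω r) / 2

/-- The bound on the distance from `gvMid` to the midpoint of the true Voronoi segment. -/
def ubd (ω : ℝ) (r : RobotState) : ℝ := ω * r.tau / 2

/-- The angular speed prescribed by the control law. -/
def speed (ω Δt : ℝ) (r : RobotState) : ℝ :=
  if ubd ω r + ω * Δt ≤ |gvMid ω r - r.pos| then ω
  else if |gvMid ω r - r.pos| ≤ ubd ω r then 0
  else (|gvMid ω r - r.pos| - ubd ω r) / Δt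

/-- The control law: move towards `gvMid`. -/
def control (ω Δt : ℝ) (r : RobotState) : ℝ :=
  speed ω Δt r * Real.sign (gvMid ω r - r.pos)

/-- The position that the control law leads to after one time step. -/
def newPos (ω Δt : ℝ) (r : RobotState) : ℝ := r.pos + Δt * control ω Δt r

/-- The accuracy condition, relaxed by the tolerance `σ`. -/
def AccuracyCondition (ω Δt σ : ℝ) (r : RobotState) : Prop :=
  ubd ω r < max |newPos ω Δt r - gvMid ω r| σ

/-- The robot cannot have swapped its place with a neighbour. -/
def OrderCondition (ω : ℝ) (r : RobotState) : Prop :=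
  r.pos < r.next - ω * r.tau ∧ r.prev + ω * r.tau < r.pos

open Classical in
/-- State of robot `i` after the information part of one pass of the loop: the elapsed time is
incremented and, if one of the two conditions fails, the present positions of both neighbours are
collected and the elapsed time is reset. -/
def informed {N : ℕ} (ω Δt σ : ℝ) (S : Fin N → RobotState) (i : Fin N) : RobotState :=
  let r : RobotState := { S i with tau := (S i).tau + Δt }
  if AccuracyCondition ω Δt σ r ∧ OrderCondition ω r then r
  else
    { pos := r.pos
      prev := prevAngle (fun j => (S j).pos) i
      next := nextAngle (fun j => (S j).pos) i
      tau := 0 }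

/-- The command `u_i` that robot `i` applies during a time step that starts in `S`. -/
def command {N : ℕ} (ω Δt σ : ℝ) (S : Fin N → RobotState) (i : Fin N) : ℝ :=
  control ω Δt (informed ω Δt σ S i)

/-- One pass of the loop, all robots acting simultaneously. -/
def step {N : ℕ} (ω Δt σ : ℝ) (S : Fin N → RobotState) : Fin N → RobotState :=
  fun i => { informed ω Δt σ S i with pos := (S i).pos + Δt * command ω Δt σ S i }

/-- The state of the team at time `k Δt`, from the initial state `S`. -/
def run {N : ℕ} (ω Δt σ : ℝ) (S : Fin N → RobotState) (k : ℕ) : Fin N → RobotState :=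
  (step ω Δt σ)^[k] S

/-- The angle of robot `i` at the real time `t ≥ 0`: commands are constant during a time step. -/
def angleAt {N : ℕ} (ω Δt σ : ℝ) (S : Fin N → RobotState) (i : Fin N) (t : ℝ) : ℝ :=
  (run ω Δt σ S ⌊t / Δt⌋₊ i).pos
    + (t - ⌊t / Δt⌋₊ * Δt) * command ω Δt σ (run ω Δt σ S ⌊t / Δt⌋₊) i

/-- An initial state of the team in the configuration `θ`: the information that the robots hold is
correct, that is, each neighbour lies in its motion prediction set. Exact knowledge of the
neighbours at elapsed time `0` is a special case. -/
structure IsInitial {N : ℕ} (ω : ℝ) (θ : Fin N → ℝ) (S : Fin N → RobotState) : Prop where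
  pos_eq : ∀ i, (S i).pos = θ i
  tau_nonneg : ∀ i, 0 ≤ (S i).tau
  prev_mem : ∀ i, |prevAngle θ i - (S i).prev| ≤ ω * (S i).tau
  next_mem : ∀ i, |nextAngle θ i - (S i).next| ≤ ω * (S i).tau

end SelfTriggered

end

/-! Subtract from each angle its place in a uniform configuration. For these deviations the extra
turn at the last robot disappears, uniformity means that they all agree, and the midpoint of the
true Voronoi segment lies at signed distance `cyclicDrift` from the robot. The computed midpoint
misses the true one by at most `ubd`, and the control law holds back by exactly this amount. So,
whatever the age of the data, each displacement `d` is a part of the drift `v`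
(`IsInformed.isPartOf`). Hence the sum of squared gaps falls by at least `4 ∑ d²` per step
(`cyclicEnergy_step_le`), and the displacements tend to zero.

This alone does not make the drifts vanish, since a robot with old data may stand still. But
eventually no robot moves at full speed, and such a robot must refresh its data within a bounded
number of steps (`exists_fresh`); at that moment `d = v` (`displacement_eq_of_fresh`). Between
refreshes `v` varies slowly, so `v → 0` (`tendsto_zero_of_window`). Vanishing drifts equalise the
gaps, whose sum around the cycle is zero, and monotonicity of the maximum turns vanishing gaps into
a common limit (`exists_consensus`). On the boundary, convergence follows from continuity of the
inverse radial map, written with the Minkowski functional. -/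

open Filter Topology

noncomputable section

namespace SelfTriggered

/-! ### Averaging on a cycle -/

/-- A quarter of the discrete Laplacian of a function on the cycle. -/
def cyclicDrift {n : ℕ} (x : Fin (n + 1) → ℝ) (i : Fin (n + 1)) : ℝ :=
  (x (i + 1) + x (i - 1) - 2 * x i) / 4

/-- `d` lies between `0` and `v`. -/
def IsPartOf (d v : ℝ) : Prop := (0 ≤ d ∧ d ≤ v) ∨ (v ≤ d ∧ d ≤ 0)

lemma IsPartOf.sq_le {d v : ℝ} (h : IsPartOf d v) : d ^ 2 ≤ d * v := by
  rcases h with h | h <;> nlinarith [h.1, h.2]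

/-- Sum of the squared gaps of a function on the cycle. -/
def cyclicEnergy {n : ℕ} (x : Fin (n + 1) → ℝ) : ℝ := ∑ i, (x (i + 1) - x i) ^ 2

lemma sum_shift {n : ℕ} (f : Fin (n + 1) → ℝ) : ∑ i, f (i + 1) = ∑ i, f i :=
  Equiv.sum_comp (Equiv.addRight (1 : Fin (n + 1))) f

/-- Summation by parts on the cycle. -/
lemma sum_gap_mul_gap {n : ℕ} (x d : Fin (n + 1) → ℝ) :
    ∑ i, (x (i + 1) - x i) * (d (i + 1) - d i) = -4 * ∑ i, d i * cyclicDrift x i := by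
  have h := sum_shift (fun i => (x i - x (i - 1)) * d i)
  simp only [add_sub_cancel_right] at h
  have h1 : ∑ i, (x (i + 1) - x i) * (d (i + 1) - d i)
      = ∑ i, (x (i + 1) - x i) * d (i + 1) - ∑ i, (x (i + 1) - x i) * d i := by
    rw [← Finset.sum_sub_distrib]; exact Finset.sum_congr rfl fun i _ => by ring
  rw [h1, h, ← Finset.sum_sub_distrib, Finset.mul_sum]
  exact Finset.sum_congr rfl fun i _ => by unfold cyclicDrift; ring

/-- The Laplacian of a cycle has no eigenvalue above 4. -/
lemma sum_gap_sq_le {n : ℕ} (d : Fin (n + 1) → ℝ) :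
    ∑ i, (d (i + 1) - d i) ^ 2 ≤ 4 * ∑ i, d i ^ 2 := by
  have h := sum_shift (fun i => d i ^ 2)
  have h1 : ∑ i, (d (i + 1) - d i) ^ 2 ≤ ∑ i, (2 * d (i + 1) ^ 2 + 2 * d i ^ 2) :=
    Finset.sum_le_sum fun i _ => by nlinarith [sq_nonneg (d (i + 1) + d i)]
  rw [Finset.sum_add_distrib, ← Finset.mul_sum, ← Finset.mul_sum, h] at h1
  linarith

/-- With `d = y - x` and drift `v`, expanding the square gives a cross term `-8 ∑ d v ≤ -8 ∑ d²` and
a quadratic term of at most `4 ∑ d²`. -/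
lemma cyclicEnergy_step_le {n : ℕ} {x y : Fin (n + 1) → ℝ}
    (h : ∀ i, IsPartOf (y i - x i) (cyclicDrift x i)) :
    cyclicEnergy y + 4 * ∑ i, (y i - x i) ^ 2 ≤ cyclicEnergy x := by
  have e : cyclicEnergy y = cyclicEnergy x
      + 2 * ∑ i, (x (i + 1) - x i) * ((y (i + 1) - x (i + 1)) - (y i - x i))
      + ∑ i, ((y (i + 1) - x (i + 1)) - (y i - x i)) ^ 2 := by
    unfold cyclicEnergy
    rw [Finset.mul_sum, ← Finset.sum_add_distrib, ← Finset.sum_add_distrib]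
    exact Finset.sum_congr rfl fun i _ => by ring
  have h1 := sum_gap_mul_gap x (fun i => y i - x i)
  have h2 := sum_gap_sq_le (fun i => y i - x i)
  have h3 : ∑ i, (y i - x i) ^ 2 ≤ ∑ i, (y i - x i) * cyclicDrift x i :=
    Finset.sum_le_sum fun i _ => (h i).sq_le
  rw [e, h1]
  linarith

lemma tendsto_increment_zero {n : ℕ} {x : ℕ → Fin (n + 1) → ℝ}
    (h : ∀ k i, IsPartOf (x (k + 1) i - x k i) (cyclicDrift (x k) i)) (i : Fin (n + 1)) :
    Tendsto (fun k => x (k + 1) i - x k i) atTop (𝓝 0) := by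
  set E := fun k => cyclicEnergy (x k)
  have hstep : ∀ k, E (k + 1) + 4 * ∑ i, (x (k + 1) i - x k i) ^ 2 ≤ E k :=
    fun k => cyclicEnergy_step_le (h k)
  have hanti : Antitone E := antitone_nat_of_succ_le fun k => by
    have : 0 ≤ ∑ i, (x (k + 1) i - x k i) ^ 2 := Finset.sum_nonneg fun i _ => sq_nonneg _
    linarith [hstep k]
  have hbdd : BddBelow (Set.range E) :=
    ⟨0, by rintro _ ⟨k, rfl⟩; exact Finset.sum_nonneg fun i _ => sq_nonneg _⟩
  have hlim := tendsto_atTop_ciInf hanti hbdd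
  have hdiff : Tendsto (fun k => E k - E (k + 1)) atTop (𝓝 0) := by
    simpa using hlim.sub (hlim.comp (tendsto_add_atTop_nat 1))
  have hsq : Tendsto (fun k => (x (k + 1) i - x k i) ^ 2) atTop (𝓝 0) := by
    refine squeeze_zero (fun k => sq_nonneg _) (fun k => ?_) hdiff
    have h1 : (x (k + 1) i - x k i) ^ 2 ≤ ∑ i, (x (k + 1) i - x k i) ^ 2 :=
      Finset.single_le_sum (f := fun i => (x (k + 1) i - x k i) ^ 2)
        (fun i _ => sq_nonneg _) (Finset.mem_univ i)
    linarith [hstep k, sq_nonneg (x (k + 1) i - x k i)]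
  have := hsq.sqrt
  simp only [Real.sqrt_sq_eq_abs, Real.sqrt_zero] at this
  exact (tendsto_zero_iff_abs_tendsto_zero _).2 this

/-- A slowly varying sequence that is small at least once in each window of fixed length tends
to zero. -/
lemma tendsto_zero_of_window {v d : ℕ → ℝ} (hd : Tendsto d atTop (𝓝 0))
    (hv : Tendsto (fun k => v (k + 1) - v k) atTop (𝓝 0)) (M : ℕ)
    (hw : ∀ᶠ k in atTop, ∃ m ≤ M, |v (k + m)| ≤ |d (k + m)|) :
    Tendsto v atTop (𝓝 0) := by
  rw [Metric.tendsto_atTop]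
  intro ε hε
  have hδ : 0 < ε / (M + 2) := by positivity
  obtain ⟨K₁, h₁⟩ := (Metric.tendsto_atTop.1 hd) _ hδ
  obtain ⟨K₂, h₂⟩ := (Metric.tendsto_atTop.1 hv) _ hδ
  obtain ⟨K₃, h₃⟩ := eventually_atTop.1 hw
  simp only [Real.dist_eq, sub_zero] at *
  have drift : ∀ m k, K₂ ≤ k → |v k| ≤ |v (k + m)| + m * (ε / (M + 2)) := by
    intro m
    induction m with
    -- The window costs at most `M` increments of `v` and one value of `d`, so `M + 2` shares of `ε`
    -- leave one to spare.
    | zero => intro k _; simp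
    | succ m ih =>
      intro k hk
      have a := ih k hk
      have b := h₂ (k + m) (by omega)
      have c := abs_sub_abs_le_abs_sub (v (k + m)) (v (k + m + 1))
      rw [abs_sub_comm] at c
      push_cast
      rw [← add_assoc k m 1]
      linarith
  refine ⟨max K₁ (max K₂ K₃), fun k hk => ?_⟩
  simp only [ge_iff_le, max_le_iff] at hk
  obtain ⟨m, hm, hvm⟩ := h₃ k hk.2.2
  have a := drift m k hk.2.1
  have b := h₁ (k + m) (by omega)
  have c : (m : ℝ) * (ε / (M + 2)) ≤ M * (ε / (M + 2)) := by gcongr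
  have e : (M : ℝ) * (ε / (M + 2)) + 2 * (ε / (M + 2)) = ε := by field_simp
  linarith

lemma sub_tendsto_zero_of_succ {n : ℕ} {y : ℕ → Fin (n + 1) → ℝ}
    (h : ∀ i, Tendsto (fun k => y k (i + 1) - y k i) atTop (𝓝 0)) (i j : Fin (n + 1)) :
    Tendsto (fun k => y k i - y k j) atTop (𝓝 0) := by
  have key : ∀ i : Fin (n + 1), Tendsto (fun k => y k i - y k 0) atTop (𝓝 0) := by
    intro i
    induction i using Fin.induction with
    | zero => simp
    | succ i ih =>
      have := (h i.castSucc).add ih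
      rw [Fin.coeSucc_eq_succ] at this
      simpa using this
  simpa using (key i).sub (key j)

/-- A drift is a quarter of the difference of consecutive gaps. So all gaps become equal, and each
is asymptotically their mean, which is zero. -/
lemma gap_tendsto_zero {n : ℕ} {x : ℕ → Fin (n + 1) → ℝ}
    (h : ∀ i, Tendsto (fun k => cyclicDrift (x k) i) atTop (𝓝 0)) (i : Fin (n + 1)) :
    Tendsto (fun k => x k (i + 1) - x k i) atTop (𝓝 0) := by
  have h1 : ∀ j, Tendsto (fun k => (x k (j + 1 + 1) - x k (j + 1)) - (x k (j + 1) - x k j))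
      atTop (𝓝 0) := by
    intro j
    have := (h (j + 1)).const_mul 4
    simp only [cyclicDrift, add_sub_cancel_right, mul_zero] at this
    exact this.congr fun k => by ring
  have h2 := sub_tendsto_zero_of_succ (y := fun k j => x k (j + 1) - x k j) h1
  have h3 : Tendsto (fun k => ∑ j, ((x k (i + 1) - x k i) - (x k (j + 1) - x k j)))
      atTop (𝓝 0) := by
    simpa using tendsto_finsetSum Finset.univ fun j _ => h2 i j
  have h4 : ∀ k, ∑ j, ((x k (i + 1) - x k i) - (x k (j + 1) - x k j))
      = (n + 1) * (x k (i + 1) - x k i) := by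
    intro k
    have h5 : ∑ j, (x k (j + 1) - x k j) = 0 := by
      rw [Finset.sum_sub_distrib, sum_shift (x k), sub_self]
    rw [Finset.sum_sub_distrib, h5]
    simp [mul_sub]
  simp only [h4] at h3
  have h5 := h3.const_mul ((n + 1 : ℝ)⁻¹)
  rw [mul_zero] at h5
  refine h5.congr fun k => ?_
  have : (n + 1 : ℝ) ≠ 0 := by positivity
  field_simp

/-- Cyclic averaging whose drifts vanish reaches a consensus. -/
lemma exists_consensus {n : ℕ} {x : ℕ → Fin (n + 1) → ℝ}
    (h : ∀ k i, IsPartOf (x (k + 1) i - x k i) (cyclicDrift (x k) i))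
    (h0 : ∀ i, Tendsto (fun k => cyclicDrift (x k) i) atTop (𝓝 0)) :
    ∃ c, ∀ i, Tendsto (fun k => x k i) atTop (𝓝 c) := by
  have hx := sub_tendsto_zero_of_succ (gap_tendsto_zero h0)
  set M := fun k => Finset.univ.sup' Finset.univ_nonempty (x k)
  have hle : ∀ k i, x k i ≤ M k := fun k i => Finset.le_sup' (x k) (Finset.mem_univ i)
  -- The full drift leads halfway to the mean of the two neighbours, so each new value is a convex
  -- combination of old ones.
  have hanti : Antitone M := antitone_nat_of_succ_le fun k => by
    refine Finset.sup'_le _ _ fun i _ => ?_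
    have a := hle k i
    have b := hle k (i + 1)
    have c := hle k (i - 1)
    have e := h k i
    unfold IsPartOf cyclicDrift at e
    rcases e with e | e <;> linarith
  obtain ⟨L, hL⟩ : ∃ L, ∀ i, L ≤ x 0 i :=
    ⟨Finset.univ.inf' Finset.univ_nonempty (x 0), fun i => Finset.inf'_le _ (Finset.mem_univ i)⟩
  have hLk : ∀ k i, L ≤ x k i := by
    intro k
    induction k with
    | zero => exact hL
    | succ k ih =>
      intro i
      have a := ih i
      have b := ih (i + 1)
      have c := ih (i - 1)
      have e := h k i
      unfold IsPartOf cyclicDrift at e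
      rcases e with e | e <;> linarith
  have hlim := tendsto_atTop_ciInf hanti
    ⟨L, by rintro _ ⟨k, rfl⟩; exact (hLk k 0).trans (hle k 0)⟩
  refine ⟨⨅ k, M k, fun i => ?_⟩
  have hsum : Tendsto (fun k => ∑ j, |x k j - x k i|) atTop (𝓝 0) := by
    simpa using tendsto_finsetSum Finset.univ fun j _ => (hx j i).abs
  have hdiff : Tendsto (fun k => M k - x k i) atTop (𝓝 0) := by
    refine squeeze_zero (fun k => sub_nonneg.2 (hle k i)) (fun k => ?_) hsum
    rw [sub_le_iff_le_add]
    refine Finset.sup'_le _ _ fun j _ => ?_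
    have := Finset.single_le_sum (f := fun j => |x k j - x k i|)
      (fun j _ => abs_nonneg _) (Finset.mem_univ j)
    have := le_abs_self (x k j - x k i)
    linarith
  simpa using hlim.sub hdiff

/-! ### The control law of a single robot -/

section Robot

variable {ω Δt σ : ℝ} {r : RobotState}

lemma gvMid_sub_pos (ω : ℝ) (r : RobotState) :
    gvMid ω r - r.pos = (r.next + r.prev - 2 * r.pos) / 4 := by
  unfold gvMid gvsUpper gvsLower; ring

lemma ubd_nonneg (hω : 0 < ω) (hτ : 0 ≤ r.tau) : 0 ≤ ubd ω r := by unfold ubd; positivity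

/-- The displacement during one time step, by cases. -/
lemma displacement_cases (ω : ℝ) (r : RobotState) (hΔt : 0 < Δt) :
    (ubd ω r + ω * Δt ≤ |gvMid ω r - r.pos| ∧
      Δt * control ω Δt r = ω * Δt * Real.sign (gvMid ω r - r.pos)) ∨
    (|gvMid ω r - r.pos| ≤ ubd ω r ∧ Δt * control ω Δt r = 0) ∨
    (ubd ω r < |gvMid ω r - r.pos| ∧ |gvMid ω r - r.pos| < ubd ω r + ω * Δt ∧
      Δt * control ω Δt r =
        (|gvMid ω r - r.pos| - ubd ω r) * Real.sign (gvMid ω r - r.pos)) := by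
  unfold control speed
  split_ifs with h₁ h₂
  · exact Or.inl ⟨h₁, by ring⟩
  · exact Or.inr (Or.inl ⟨h₂, by ring⟩)
  · exact Or.inr (Or.inr ⟨not_le.1 h₂, not_le.1 h₁, by field_simp⟩)

lemma abs_displacement_le (hω : 0 < ω) (hΔt : 0 < Δt) :
    |Δt * control ω Δt r| ≤ ω * Δt := by
  have hp : 0 < ω * Δt := by positivity
  have hs : |Real.sign (gvMid ω r - r.pos)| ≤ 1 := by
    rcases Real.sign_apply_eq (gvMid ω r - r.pos) with h | h | h <;> rw [h] <;> norm_num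
  rcases displacement_cases ω r hΔt with ⟨-, e⟩ | ⟨-, e⟩ | ⟨h₁, h₂, e⟩
  · rw [e, abs_mul, abs_of_pos hp]; nlinarith
  · rw [e, abs_zero]; exact hp.le
  · rw [e, abs_mul, abs_of_pos (by linarith)]
    nlinarith [abs_nonneg (Real.sign (gvMid ω r - r.pos))]

/-- With correct information, the robot moves towards the midpoint of the true Voronoi segment
and does not pass it. -/
lemma isPartOf_displacement (hω : 0 < ω) (hΔt : 0 < Δt) (hτ : 0 ≤ r.tau) {v : ℝ}
    (hv : |v - (gvMid ω r - r.pos)| ≤ ubd ω r) : IsPartOf (Δt * control ω Δt r) v := by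
  have hp : 0 < ω * Δt := by positivity
  have hb := ubd_nonneg hω hτ
  have hcase := displacement_cases ω r hΔt
  generalize gvMid ω r - r.pos = g at *
  rw [abs_le] at hv
  unfold IsPartOf
  rcases lt_trichotomy g 0 with hg | hg | hg
  · rw [Real.sign_of_neg hg, abs_of_neg hg] at hcase
    rcases hcase with ⟨h, e⟩ | ⟨h, e⟩ | ⟨h, h', e⟩ <;> rw [e]
    · right; constructor <;> linarith
    · rcases le_total 0 v with h | h <;> simp [h]
    · right; constructor <;> linarith
  -- Here `Real.sign 0 = 0` decides.
  · have e : Δt * control ω Δt r = 0 := by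
      rcases hcase with ⟨-, e⟩ | ⟨-, e⟩ | ⟨-, -, e⟩ <;> simp [e, hg]
    rw [e]
    rcases le_total 0 v with h | h <;> simp [h]
  · rw [Real.sign_of_pos hg, abs_of_pos hg] at hcase
    rcases hcase with ⟨h, e⟩ | ⟨h, e⟩ | ⟨h, h', e⟩ <;> rw [e]
    · left; constructor <;> linarith
    · rcases le_total 0 v with h | h <;> simp [h]
    · left; constructor <;> linarith

/-- With fresh information, a robot that does not move at full speed reaches the midpoint. -/
lemma displacement_eq_of_fresh (hω : 0 < ω) (hΔt : 0 < Δt) (hτ : r.tau = 0)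
    (h : |Δt * control ω Δt r| < ω * Δt) : Δt * control ω Δt r = gvMid ω r - r.pos := by
  have hp : 0 < ω * Δt := by positivity
  have hb : ubd ω r = 0 := by simp [ubd, hτ]
  have hcase := displacement_cases ω r hΔt
  rw [hb] at hcase
  generalize gvMid ω r - r.pos = g at *
  rcases hcase with ⟨h₁, e⟩ | ⟨h₁, e⟩ | ⟨h₁, -, e⟩
  · rcases lt_trichotomy g 0 with hg | hg | hg
    · rw [e, Real.sign_of_neg hg] at h; simp [abs_of_pos hω, abs_of_pos hΔt] at h
    · rw [hg, abs_zero] at h₁; linarith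
    · rw [e, Real.sign_of_pos hg] at h; simp [abs_of_pos hω, abs_of_pos hΔt] at h
  · rw [e, abs_nonpos_iff.1 h₁]
  · rw [e, sub_zero]
    rcases lt_trichotomy g 0 with hg | hg | hg
    · rw [Real.sign_of_neg hg, abs_of_neg hg]; ring
    · simp [hg]
    · rw [Real.sign_of_pos hg, abs_of_pos hg]; ring

/-- Once the information is so old that the tolerance is used up, it is kept only by a robot that
moves at full speed. -/
lemma le_abs_displacement_of_accuracy (hω : 0 < ω) (hΔt : 0 < Δt) (hτ : 0 ≤ r.tau)
    (hσ : σ ≤ ubd ω r) (h : AccuracyCondition ω Δt σ r) : ω * Δt ≤ |Δt * control ω Δt r| := by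
  have hp : 0 < ω * Δt := by positivity
  have hb := ubd_nonneg hω hτ
  have hcase := displacement_cases ω r hΔt
  -- Since `σ ≤ ubd`, only the first entry of the maximum can exceed `ubd`.
  have hacc : ubd ω r < |Δt * control ω Δt r - (gvMid ω r - r.pos)| := by
    rcases lt_max_iff.1 h with h | h
    · rw [newPos] at h
      rwa [show Δt * control ω Δt r - (gvMid ω r - r.pos)
        = r.pos + Δt * control ω Δt r - gvMid ω r by ring]
    · linarith
  generalize gvMid ω r - r.pos = g at *
  rcases hcase with ⟨h₁, e⟩ | ⟨h₁, e⟩ | ⟨h₁, h₂, e⟩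
  · rcases lt_trichotomy g 0 with hg | hg | hg
    · rw [e, Real.sign_of_neg hg]; simp [abs_of_pos hω, abs_of_pos hΔt]
    · rw [hg, abs_zero] at h₁; linarith
    · rw [e, Real.sign_of_pos hg]; simp [abs_of_pos hω, abs_of_pos hΔt]
  · rw [e, zero_sub, abs_neg] at hacc; linarith
  -- At intermediate speed the robot stops at distance exactly `ubd` from `gvMid`, against the
  -- strict inequality.
  · exfalso
    rcases lt_trichotomy g 0 with hg | hg | hg
    · rw [e, Real.sign_of_neg hg, abs_of_neg hg, abs_of_nonneg (by linarith)] at hacc; linarith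
    · rw [hg, abs_zero] at h₁; linarith
    · rw [e, Real.sign_of_pos hg, abs_of_pos hg, abs_of_nonpos (by linarith)] at hacc; linarith

end Robot

/-! ### Deviations from a uniform configuration -/

section Angles

/-- Deviation of the configuration from the uniform one that starts at angle `0`. -/
def deviation {n : ℕ} (θ : Fin (n + 1) → ℝ) (i : Fin (n + 1)) : ℝ :=
  θ i - 2 * Real.pi * (i : ℕ) / (n + 1)

/-- Addition in `Fin (n + 1)` wraps around; the lost `n + 1` steps of `2π / (n + 1)` are the turn
added in `nextAngle`. -/
lemma nextAngle_eq {n : ℕ} (θ : Fin (n + 1) → ℝ) (i : Fin (n + 1)) :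
    nextAngle θ i = θ i + (deviation θ (i + 1) - deviation θ i) + 2 * Real.pi / (n + 1) := by
  have hn : (n + 1 : ℝ) ≠ 0 := by positivity
  have hv := Fin.val_add_one i
  unfold nextAngle deviation
  split_ifs with h
  · have hi : i ≠ Fin.last n := by rintro rfl; simp at h
    rw [if_neg hi] at hv
    have e : (⟨(i : ℕ) + 1, h⟩ : Fin (n + 1)) = i + 1 := Fin.ext hv.symm
    rw [e, hv]
    push_cast
    field_simp
    ring
  · have hi : i = Fin.last n := Fin.ext (by rw [Fin.val_last]; omega)
    rw [if_pos hi] at hv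
    have e : (⟨0, Nat.lt_of_le_of_lt (Nat.zero_le _) i.isLt⟩ : Fin (n + 1)) = i + 1 :=
      Fin.ext hv.symm
    rw [e, hv, hi, Fin.val_last]
    push_cast
    field_simp
    ring

lemma prevAngle_eq {n : ℕ} (θ : Fin (n + 1) → ℝ) (i : Fin (n + 1)) :
    prevAngle θ i = θ i + (deviation θ (i - 1) - deviation θ i) - 2 * Real.pi / (n + 1) := by
  have hn : (n + 1 : ℝ) ≠ 0 := by positivity
  have hv := Fin.coe_sub_one i
  unfold prevAngle deviation
  split_ifs with h
  · have hi : i = 0 := Fin.ext h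
    rw [if_pos hi] at hv
    have e : (⟨n + 1 - 1, Nat.sub_lt (Nat.lt_of_le_of_lt (Nat.zero_le _) i.isLt) Nat.one_pos⟩ :
      Fin (n + 1)) = i - 1 := Fin.ext hv.symm
    rw [e, hv, h]
    push_cast
    field_simp
    ring
  · have hi : i ≠ 0 := by rintro rfl; simp at h
    rw [if_neg hi] at hv
    have e : (⟨(i : ℕ) - 1, Nat.lt_of_le_of_lt (Nat.sub_le _ _) i.isLt⟩ : Fin (n + 1)) = i - 1 :=
      Fin.ext hv.symm
    rw [e, hv, Nat.cast_sub (by omega)]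
    push_cast
    field_simp
    ring

lemma cyclicDrift_deviation {n : ℕ} (θ : Fin (n + 1) → ℝ) (i : Fin (n + 1)) :
    cyclicDrift (deviation θ) i = (nextAngle θ i + prevAngle θ i - 2 * θ i) / 4 := by
  rw [nextAngle_eq, prevAngle_eq, cyclicDrift]; ring

lemma abs_prevAngle_sub_le {N : ℕ} {θ θ' : Fin N → ℝ} {B : ℝ} (h : ∀ i, |θ' i - θ i| ≤ B)
    (i : Fin N) : |prevAngle θ' i - prevAngle θ i| ≤ B := by
  unfold prevAngle
  split_ifs
  · rw [sub_sub_sub_cancel_right]; exact h _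
  · exact h _

lemma abs_nextAngle_sub_le {N : ℕ} {θ θ' : Fin N → ℝ} {B : ℝ} (h : ∀ i, |θ' i - θ i| ≤ B)
    (i : Fin N) : |nextAngle θ' i - nextAngle θ i| ≤ B := by
  unfold nextAngle
  split_ifs
  · exact h _
  · rw [add_sub_add_right_eq_sub]; exact h _

end Angles

/-! ### Dynamics of the team -/

section Team

variable {N : ℕ} {ω Δt σ : ℝ}

/-- The positions of the robots. -/
def positions (S : Fin N → RobotState) (i : Fin N) : ℝ := (S i).pos

/-- The stored neighbour positions will be correct after the elapsed time is incremented. -/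
structure IsInformed (ω Δt : ℝ) (S : Fin N → RobotState) : Prop where
  tau_nonneg : ∀ i, 0 ≤ (S i).tau
  prev_mem : ∀ i, |prevAngle (positions S) i - (S i).prev| ≤ ω * ((S i).tau + Δt)
  next_mem : ∀ i, |nextAngle (positions S) i - (S i).next| ≤ ω * ((S i).tau + Δt)

lemma IsInitial.isInformed {θ : Fin N → ℝ} {S : Fin N → RobotState} (h : IsInitial ω θ S)
    (hω : 0 < ω) (hΔt : 0 < Δt) : IsInformed ω Δt S := by
  have e : positions S = θ := funext h.pos_eq
  have hp : 0 < ω * Δt := by positivity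
  refine ⟨h.tau_nonneg, fun i => ?_, fun i => ?_⟩ <;> rw [e, mul_add]
  · linarith [h.prev_mem i]
  · linarith [h.next_mem i]

lemma informed_pos (S : Fin N → RobotState) (i : Fin N) :
    (informed ω Δt σ S i).pos = (S i).pos := by
  unfold informed; dsimp only; split_ifs <;> rfl

lemma IsInformed.informed {S : Fin N → RobotState} (h : IsInformed ω Δt S) (hΔt : 0 < Δt)
    (i : Fin N) :
    0 ≤ (informed ω Δt σ S i).tau ∧
    |prevAngle (positions S) i - (informed ω Δt σ S i).prev| ≤ ω * (informed ω Δt σ S i).tau ∧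
    |nextAngle (positions S) i - (informed ω Δt σ S i).next| ≤ ω * (informed ω Δt σ S i).tau := by
  unfold SelfTriggered.informed
  dsimp only
  split_ifs
  · exact ⟨add_nonneg (h.tau_nonneg i) hΔt.le, h.prev_mem i, h.next_mem i⟩
  · unfold positions; simp

lemma step_pos (S : Fin N → RobotState) (i : Fin N) :
    (step ω Δt σ S i).pos - (S i).pos = Δt * control ω Δt (informed ω Δt σ S i) := by
  simp [step, command]

lemma abs_step_pos_sub_le (S : Fin N → RobotState) (hω : 0 < ω) (hΔt : 0 < Δt) (i : Fin N) :
    |(step ω Δt σ S i).pos - (S i).pos| ≤ ω * Δt := by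
  rw [step_pos]; exact abs_displacement_le hω hΔt

/-- A neighbour moves by at most `ω Δt` during the step; the next increment of the elapsed time pays
for this. -/
lemma IsInformed.step {S : Fin N → RobotState} (h : IsInformed ω Δt S)
    (hω : 0 < ω) (hΔt : 0 < Δt) : IsInformed ω Δt (step ω Δt σ S) := by
  have hm : ∀ i, |positions (SelfTriggered.step ω Δt σ S) i - positions S i| ≤ ω * Δt :=
    abs_step_pos_sub_le S hω hΔt
  refine ⟨fun i => (h.informed hΔt i).1, fun i => ?_, fun i => ?_⟩
  · have h₁ := abs_prevAngle_sub_le hm i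
    have h₂ := (h.informed (σ := σ) hΔt i).2.1
    refine (abs_sub_le _ (prevAngle (positions S) i) _).trans ?_
    rw [mul_add, add_comm]
    exact add_le_add h₂ h₁
  · have h₁ := abs_nextAngle_sub_le hm i
    have h₂ := (h.informed (σ := σ) hΔt i).2.2
    refine (abs_sub_le _ (nextAngle (positions S) i) _).trans ?_
    rw [mul_add, add_comm]
    exact add_le_add h₂ h₁

lemma run_succ (S : Fin N → RobotState) (k : ℕ) :
    run ω Δt σ S (k + 1) = step ω Δt σ (run ω Δt σ S k) :=
  Function.iterate_succ_apply' _ _ _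

lemma IsInformed.run {S : Fin N → RobotState} (h : IsInformed ω Δt S)
    (hω : 0 < ω) (hΔt : 0 < Δt) (k : ℕ) : IsInformed ω Δt (run ω Δt σ S k) := by
  induction k with
  | zero => exact h
  | succ k ih => rw [run_succ]; exact ih.step hω hΔt

lemma deviation_step_sub {n : ℕ} (S : Fin (n + 1) → RobotState) (i : Fin (n + 1)) :
    deviation (positions (step ω Δt σ S)) i - deviation (positions S) i
      = Δt * control ω Δt (informed ω Δt σ S i) := by
  rw [← step_pos]; unfold deviation positions; ring

/-- Two neighbour errors of at most `ω τ`, each weighted by 1/4, add up to at most `ω τ / 2`, which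
is `ubd`. -/
lemma IsInformed.isPartOf {n : ℕ} {S : Fin (n + 1) → RobotState} (h : IsInformed ω Δt S)
    (hω : 0 < ω) (hΔt : 0 < Δt) (i : Fin (n + 1)) :
    IsPartOf (deviation (positions (SelfTriggered.step ω Δt σ S)) i - deviation (positions S) i)
      (cyclicDrift (deviation (positions S)) i) := by
  obtain ⟨h₁, h₂, h₃⟩ := h.informed (σ := σ) hΔt i
  rw [deviation_step_sub]
  refine isPartOf_displacement hω hΔt h₁ ?_
  rw [gvMid_sub_pos, cyclicDrift_deviation, informed_pos, ubd]
  rw [abs_le] at *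
  have e : positions S i = (S i).pos := rfl
  rw [e]
  constructor <;> linarith [h₂.1, h₂.2, h₃.1, h₃.2]

lemma informed_fresh_or_accurate (S : Fin N → RobotState) (i : Fin N) :
    (informed ω Δt σ S i = ⟨(S i).pos, prevAngle (positions S) i, nextAngle (positions S) i, 0⟩) ∨
    ((informed ω Δt σ S i).tau = (S i).tau + Δt ∧
      AccuracyCondition ω Δt σ (informed ω Δt σ S i)) := by
  by_cases h : AccuracyCondition ω Δt σ { S i with tau := (S i).tau + Δt } ∧
      OrderCondition ω { S i with tau := (S i).tau + Δt }
  · right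
    have e : informed ω Δt σ S i = { S i with tau := (S i).tau + Δt } := by
      unfold informed; dsimp only; rw [if_pos h]
    rw [e]
    exact ⟨rfl, h.1⟩
  · left
    unfold informed; dsimp only; rw [if_neg h]; rfl

/-- A robot that never moves at full speed collects new information within a bounded number of
steps. -/
lemma exists_fresh {S : Fin N → RobotState} (h : IsInformed ω Δt S)
    (hω : 0 < ω) (hΔt : 0 < Δt) {M : ℕ} (hM : σ ≤ ω * (M * Δt) / 2) (i : Fin N) (k : ℕ)
    (hslow : ∀ l ≥ k, |Δt * control ω Δt (informed ω Δt σ (run ω Δt σ S l) i)| < ω * Δt) :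
    ∃ m ≤ M, informed ω Δt σ (run ω Δt σ S (k + m)) i =
      ⟨(run ω Δt σ S (k + m) i).pos, prevAngle (positions (run ω Δt σ S (k + m))) i,
        nextAngle (positions (run ω Δt σ S (k + m))) i, 0⟩ := by
  by_contra! hno
  have hstale : ∀ m ≤ M, (informed ω Δt σ (run ω Δt σ S (k + m)) i).tau
        = (run ω Δt σ S (k + m) i).tau + Δt ∧
      AccuracyCondition ω Δt σ (informed ω Δt σ (run ω Δt σ S (k + m)) i) :=
    fun m hm => (informed_fresh_or_accurate _ i).resolve_left (hno m hm)
  -- Without a refresh the data age by `Δt` per step, until `ubd` has used up the tolerance `σ`.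
  have hage : ∀ m ≤ M, m * Δt ≤ (run ω Δt σ S (k + m) i).tau := by
    intro m
    induction m with
    | zero => intro _; simpa using (h.run hω hΔt k).tau_nonneg i
    | succ m ih =>
      intro hm
      have h₁ := ih (by omega)
      have h₂ := (hstale m (by omega)).1
      have h₃ : (run ω Δt σ S (k + (m + 1)) i).tau
          = (informed ω Δt σ (run ω Δt σ S (k + m)) i).tau := by
        rw [← add_assoc, run_succ]; rfl
      rw [h₃, h₂]
      push_cast
      linarith
  obtain ⟨h₁, h₂⟩ := hstale M le_rfl
  have hτ := ((h.run (σ := σ) hω hΔt (k + M)).informed (σ := σ) hΔt i).1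
  refine (hslow (k + M) (by omega)).not_ge
    (le_abs_displacement_of_accuracy hω hΔt hτ ?_ h₂)
  rw [ubd, h₁]
  have := hage M le_rfl
  have : ω * (M * Δt) ≤ ω * ((run ω Δt σ S (k + M) i).tau + Δt) := by gcongr; linarith
  linarith

lemma tendsto_displacement_zero {n : ℕ} {S : Fin (n + 1) → RobotState} (h : IsInformed ω Δt S)
    (hω : 0 < ω) (hΔt : 0 < Δt) (i : Fin (n + 1)) :
    Tendsto (fun k => Δt * command ω Δt σ (run ω Δt σ S k) i) atTop (𝓝 0) := by
  have := tendsto_increment_zero (x := fun k => deviation (positions (run ω Δt σ S k)))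
    (fun k i => by rw [run_succ]; exact (h.run hω hΔt k).isPartOf hω hΔt i) i
  refine this.congr fun k => ?_
  rw [run_succ, deviation_step_sub, command]

lemma tendsto_cyclicDrift_zero {n : ℕ} {S : Fin (n + 1) → RobotState} (h : IsInformed ω Δt S)
    (hω : 0 < ω) (hΔt : 0 < Δt) (i : Fin (n + 1)) :
    Tendsto (fun k => cyclicDrift (deviation (positions (run ω Δt σ S k))) i) atTop (𝓝 0) := by
  have hd := tendsto_displacement_zero (σ := σ) h hω hΔt
  have hp : 0 < ω * Δt := by positivity
  -- After `M` steps without a refresh, `ubd` is at least `ω M Δt / 2 ≥ σ`.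
  obtain ⟨M, hM⟩ := exists_nat_ge (2 * σ / (ω * Δt))
  rw [div_le_iff₀ hp] at hM
  refine tendsto_zero_of_window (hd i) ?_ M ?_
  -- The drift is linear in the deviations, so its increments are combinations of displacements.
  · have := (((hd (i + 1)).add (hd (i - 1))).sub ((hd i).const_mul 2)).div_const 4
    simp only [add_zero, mul_zero, sub_zero, zero_div] at this
    refine this.congr fun k => ?_
    simp only [command, ← deviation_step_sub, ← run_succ, cyclicDrift]
    ring
  · have hsmall : ∀ᶠ k in atTop, |Δt * command ω Δt σ (run ω Δt σ S k) i| < ω * Δt := by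
      have := (hd i).abs
      rw [abs_zero] at this
      exact this.eventually_lt_const hp
    obtain ⟨K, hK⟩ := eventually_atTop.1 hsmall
    filter_upwards [eventually_ge_atTop K] with k hk
    obtain ⟨m, hm, e⟩ := exists_fresh h hω hΔt (M := M) (by linarith) i k
      (fun l hl => hK l (by omega))
    refine ⟨m, hm, ?_⟩
    rw [command, displacement_eq_of_fresh hω hΔt (by rw [e]) (hK (k + m) (by omega)),
      gvMid_sub_pos, cyclicDrift_deviation, e]
    exact le_rfl

/-- At the sampling times, the team converges to a uniform configuration. -/
lemma exists_tendsto_run {S : Fin N → RobotState} (h : IsInformed ω Δt S)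
    (hω : 0 < ω) (hΔt : 0 < Δt) :
    ∃ θ : Fin N → ℝ, IsUniform θ ∧ ∀ i,
      Tendsto (fun k => (run ω Δt σ S k i).pos) atTop (𝓝 (θ i)) ∧
      Tendsto (fun k => Δt * command ω Δt σ (run ω Δt σ S k) i) atTop (𝓝 0) := by
  obtain _ | n := N
  · exact ⟨fun i => i.elim0, fun i => i.elim0, fun i => i.elim0⟩
  obtain ⟨c, hc⟩ := exists_consensus (x := fun k => deviation (positions (run ω Δt σ S k)))
    (fun k i => by rw [run_succ]; exact (h.run hω hΔt k).isPartOf hω hΔt i)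
    (tendsto_cyclicDrift_zero h hω hΔt)
  refine ⟨fun i => c + 2 * Real.pi * (i : ℕ) / (n + 1), fun i => ?_, fun i =>
    ⟨?_, tendsto_displacement_zero h hω hΔt i⟩⟩
  · rw [nextAngle_eq]
    simp [deviation]
  · refine ((hc i).add_const (2 * Real.pi * (i : ℕ) / (n + 1))).congr fun k => ?_
    simp [deviation, positions]

/-- Between sampling times a robot strays from its last sampled angle by at most the displacement of
the whole step. -/
lemma tendsto_angleAt {S : Fin N → RobotState} (hΔt : 0 < Δt) {i : Fin N} {c : ℝ}
    (hpos : Tendsto (fun k => (run ω Δt σ S k i).pos) atTop (𝓝 c))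
    (hd : Tendsto (fun k => Δt * command ω Δt σ (run ω Δt σ S k) i) atTop (𝓝 0)) :
    Tendsto (fun t => angleAt ω Δt σ S i t) atTop (𝓝 c) := by
  have hfloor : Tendsto (fun t : ℝ => ⌊t / Δt⌋₊) atTop atTop :=
    tendsto_nat_floor_atTop.comp (tendsto_id.atTop_div_const hΔt)
  have hrem : Tendsto (fun t : ℝ => (t - ⌊t / Δt⌋₊ * Δt) *
      command ω Δt σ (run ω Δt σ S ⌊t / Δt⌋₊) i) atTop (𝓝 0) := by
    have hd' := (hd.comp hfloor).abs
    rw [abs_zero] at hd'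
    refine squeeze_zero_norm' ?_ hd'
    filter_upwards [eventually_ge_atTop 0] with t ht
    have h₁ := Nat.floor_le (div_nonneg ht hΔt.le)
    have h₂ := Nat.lt_floor_add_one (t / Δt)
    rw [le_div_iff₀ hΔt] at h₁
    rw [div_lt_iff₀ hΔt] at h₂
    simp only [Function.comp_apply, Real.norm_eq_abs, abs_mul]
    rw [abs_of_nonneg (sub_nonneg.2 h₁), abs_of_pos hΔt]
    exact mul_le_mul_of_nonneg_right (by linarith) (abs_nonneg _)
  simpa [angleAt] using (hpos.comp hfloor).add hrem

end Team

/-! ### The radial map and its inverse -/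

section Geometry

variable {Q : Set ℂ} {o : ℂ}

/-- The environment seen from the target. -/
def centered (Q : Set ℂ) (o : ℂ) : Set ℂ := (fun z => z + o) ⁻¹' Q

/-- The point of the frontier in direction `u`, in terms of the Minkowski functional. -/
def radialInverse (Q : Set ℂ) (o u : ℂ) : ℂ := (gauge (centered Q o) u)⁻¹ • u + o

lemma centered_mem_nhds (ho : o ∈ interior Q) : centered Q o ∈ 𝓝 0 := by
  have hc : ContinuousAt (fun z : ℂ => z + o) 0 := by fun_prop
  refine hc.preimage_mem_nhds ?_
  rw [zero_add]
  exact mem_interior_iff_mem_nhds.1 ho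

lemma convex_centered (hQ : Convex ℝ Q) : Convex ℝ (centered Q o) := hQ.translate_preimage_left o

lemma gauge_centered_pos (hb : Bornology.IsBounded Q) (ho : o ∈ interior Q) {u : ℂ}
    (hu : u ≠ 0) : 0 < gauge (centered Q o) u := by
  refine (gauge_pos (absorbent_nhds_zero (centered_mem_nhds ho)) ?_).2 hu
  refine NormedSpace.isVonNBounded_of_isBounded ℝ ?_
  obtain ⟨R, hR⟩ := isBounded_iff_forall_norm_le.1 hb
  refine isBounded_iff_forall_norm_le.2 ⟨R + ‖o‖, fun z hz => ?_⟩
  have h₁ := hR _ hz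
  have h₂ := norm_sub_le (z + o) o
  rw [add_sub_cancel_right] at h₂
  linarith

/-- This makes the frontier a level set of a positively homogeneous function, so each ray from `o`
can be rescaled to meet it. -/
lemma mem_frontier_iff_gauge (hQ : Convex ℝ Q) (ho : o ∈ interior Q) (z : ℂ) :
    z + o ∈ frontier Q ↔ gauge (centered Q o) z = 1 := by
  rw [gauge_eq_one_iff_mem_frontier (convex_centered hQ) (centered_mem_nhds ho)]
  have := (Homeomorph.addRight o).preimage_frontier Q
  exact Set.ext_iff.1 this z

lemma radialInverse_mem_frontier (hQ : Convex ℝ Q) (hb : Bornology.IsBounded Q)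
    (ho : o ∈ interior Q) {u : ℂ} (hu : u ≠ 0) : radialInverse Q o u ∈ frontier Q := by
  have hg := gauge_centered_pos hb ho hu
  rw [radialInverse, mem_frontier_iff_gauge hQ ho, gauge_smul_of_nonneg (inv_nonneg.2 hg.le),
    smul_eq_mul, inv_mul_cancel₀ hg.ne']

lemma ne_of_mem_frontier (ho : o ∈ interior Q) {p : ℂ} (hp : p ∈ frontier Q) : p ≠ o := by
  rintro rfl; exact hp.2 ho

lemma norm_radialMap {p : ℂ} (hp : p ≠ o) : ‖radialMap o p‖ = 1 := by
  have : ‖p - o‖ ≠ 0 := norm_ne_zero_iff.2 (sub_ne_zero.2 hp)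
  rw [radialMap, norm_div, Complex.norm_real, norm_norm, div_self this]

lemma radialMap_radialInverse (hb : Bornology.IsBounded Q) (ho : o ∈ interior Q) {u : ℂ}
    (hu : ‖u‖ = 1) : radialMap o (radialInverse Q o u) = u := by
  have hg := gauge_centered_pos hb ho (norm_ne_zero_iff.1 (hu ▸ one_ne_zero) : u ≠ 0)
  have hg' : ((gauge (centered Q o) u : ℝ) : ℂ) ≠ 0 := Complex.ofReal_ne_zero.2 hg.ne'
  rw [radialMap, radialInverse, add_sub_cancel_right, norm_smul, hu, mul_one, norm_inv,
    Real.norm_of_nonneg hg.le, Complex.real_smul]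
  push_cast
  field_simp

lemma radialInverse_radialMap (hQ : Convex ℝ Q) (ho : o ∈ interior Q) {p : ℂ}
    (hp : p ∈ frontier Q) : radialInverse Q o (radialMap o p) = p := by
  have hn : 0 < ‖p - o‖ := norm_pos_iff.2 (sub_ne_zero.2 (ne_of_mem_frontier ho hp))
  have hn' : ((‖p - o‖ : ℝ) : ℂ) ≠ 0 := Complex.ofReal_ne_zero.2 hn.ne'
  have hg : gauge (centered Q o) (p - o) = 1 := by
    rw [← mem_frontier_iff_gauge hQ ho, sub_add_cancel]; exact hp
  have e : radialMap o p = ‖p - o‖⁻¹ • (p - o) := by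
    rw [radialMap, Complex.real_smul, div_eq_inv_mul, Complex.ofReal_inv]
  rw [radialInverse, e, gauge_smul_of_nonneg (inv_nonneg.2 hn.le), hg, smul_eq_mul, mul_one,
    inv_inv, smul_smul, mul_inv_cancel₀ hn.ne', one_smul, sub_add_cancel]

/-- The radial map is a bijection from the frontier of a bounded convex set to the circle. -/
lemma bijOn_radialMap (hQ : Convex ℝ Q) (hb : Bornology.IsBounded Q) (ho : o ∈ interior Q) :
    Set.BijOn (radialMap o) (frontier Q) (Metric.sphere (0 : ℂ) 1) := by
  refine Set.BijOn.mk (fun p hp => ?_) (fun p hp q hq h => ?_) (fun u hu => ?_)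
  · rw [mem_sphere_zero_iff_norm]; exact norm_radialMap (ne_of_mem_frontier ho hp)
  · rw [← radialInverse_radialMap hQ ho hp, h, radialInverse_radialMap hQ ho hq]
  · rw [mem_sphere_zero_iff_norm] at hu
    exact ⟨_, radialInverse_mem_frontier hQ hb ho (norm_ne_zero_iff.1 (hu ▸ one_ne_zero)),
      radialMap_radialInverse hb ho hu⟩

lemma boundaryPoint_eq (hQ : Convex ℝ Q) (hb : Bornology.IsBounded Q) (ho : o ∈ interior Q)
    (θ : ℝ) : boundaryPoint Q o θ = radialInverse Q o (Complex.exp (θ * Complex.I)) := by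
  have hu := Complex.norm_exp_ofReal_mul_I θ
  have hex : ∃ p ∈ frontier Q, radialMap o p = Complex.exp (θ * Complex.I) :=
    ⟨_, radialInverse_mem_frontier hQ hb ho (Complex.exp_ne_zero _),
      radialMap_radialInverse hb ho hu⟩
  rw [boundaryPoint, ← radialInverse_radialMap hQ ho (Function.invFunOn_mem hex),
    Function.invFunOn_eq hex]

lemma continuous_boundaryPoint (hQ : Convex ℝ Q) (hb : Bornology.IsBounded Q)
    (ho : o ∈ interior Q) : Continuous (boundaryPoint Q o) := by
  rw [funext (boundaryPoint_eq hQ hb ho)]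
  unfold radialInverse
  have hg := continuous_gauge (convex_centered hQ) (centered_mem_nhds ho)
  refine Continuous.add (Continuous.smul (Continuous.inv₀ (hg.comp (by fun_prop)) fun θ => ?_)
    (by fun_prop)) continuous_const
  exact (gauge_centered_pos hb ho (Complex.exp_ne_zero _)).ne'

/-- Points on which the radial map is injective can be numbered counterclockwise. -/
lemma exists_isCounterclockwise {N : ℕ} {p : Fin N → ℂ} (hne : ∀ i, p i ≠ o)
    (hinj : Function.Injective fun i => radialMap o (p i)) :
    ∃ (e : Equiv.Perm (Fin N)) (θ : Fin N → ℝ), IsCounterclockwise o (p ∘ e) θ := by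
  have hlift : ∀ i, radialMap o (p i)
      = Complex.exp ((Complex.arg (radialMap o (p i)) : ℝ) * Complex.I) := fun i => by
    have := Complex.norm_mul_exp_arg_mul_I (radialMap o (p i))
    rw [norm_radialMap (hne i), Complex.ofReal_one, one_mul] at this
    exact this.symm
  set f : Fin N → ℝ := fun i => Complex.arg (radialMap o (p i)) with hf
  have hfinj : Function.Injective f := fun i j h => hinj (by
    simp only
    rw [hlift i, hlift j]
    exact congrArg (fun t : ℝ => Complex.exp (t * Complex.I)) h)
  refine ⟨Tuple.sort f, f ∘ Tuple.sort f, fun i => hlift _,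
    (Tuple.monotone_sort f).strictMono_of_injective (hfinj.comp (Equiv.injective _)),
    fun i j => ?_⟩
  -- Principal arguments lie in `(-π, π]`, so any two differ by less than a turn.
  have h₁ := Complex.arg_le_pi (radialMap o (p (Tuple.sort f i)))
  have h₂ := Complex.neg_pi_lt_arg (radialMap o (p (Tuple.sort f j)))
  simp only [Function.comp_apply, hf] at *
  linarith

end Geometry

end SelfTriggered

end

theorem mainTheorem1 (N : ℕ) (V : Finset ℂ) (o : ℂ)
    (ho : o ∈ interior (SelfTriggered.polygon V))
    (ω Δt σ : ℝ) (hω : 0 < ω) (hΔt : 0 < Δt) (hσ : 0 ≤ σ)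
    (p₀ : Fin N → ℂ) (hp₀ : ∀ i, p₀ i ∈ frontier (SelfTriggered.polygon V))
    (hinj : Function.Injective p₀) :
    Set.BijOn (SelfTriggered.radialMap o) (frontier (SelfTriggered.polygon V))
        (Metric.sphere (0 : ℂ) 1) ∧
    (∃ (e : Equiv.Perm (Fin N)) (θ₀ : Fin N → ℝ),
        SelfTriggered.IsCounterclockwise o (p₀ ∘ e) θ₀) ∧
    ∀ (e : Equiv.Perm (Fin N)) (θ₀ : Fin N → ℝ),
      SelfTriggered.IsCounterclockwise o (p₀ ∘ e) θ₀ →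
      ∀ S₀ : Fin N → SelfTriggered.RobotState, SelfTriggered.IsInitial ω θ₀ S₀ →
        ∃ θlim : Fin N → ℝ, SelfTriggered.IsUniform θlim ∧
          ∀ i : Fin N,
            Filter.Tendsto (fun t : ℝ => SelfTriggered.angleAt ω Δt σ S₀ i t)
              Filter.atTop (nhds (θlim i)) ∧
            Filter.Tendsto
              (fun t : ℝ => SelfTriggered.boundaryPoint (SelfTriggered.polygon V) o
                (SelfTriggered.angleAt ω Δt σ S₀ i t))
              Filter.atTop
              (nhds (SelfTriggered.boundaryPoint (SelfTriggered.polygon V) o (θlim i))) := by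
  have hQ : Convex ℝ (SelfTriggered.polygon V) := convex_convexHull ℝ _
  have hb : Bornology.IsBounded (SelfTriggered.polygon V) :=
    (V.finite_toSet.isCompact_convexHull ℝ).isBounded
  have hbij := SelfTriggered.bijOn_radialMap hQ hb ho
  refine ⟨hbij, SelfTriggered.exists_isCounterclockwise
    (fun i => SelfTriggered.ne_of_mem_frontier ho (hp₀ i))
    (fun i j h => hinj (hbij.injOn (hp₀ i) (hp₀ j) h)), fun e θ₀ _ S₀ hS₀ => ?_⟩
  obtain ⟨θ, hθ, hlim⟩ := SelfTriggered.exists_tendsto_run (σ := σ) (hS₀.isInformed hω hΔt) hω hΔt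
  refine ⟨θ, hθ, fun i => ?_⟩
  have h := SelfTriggered.tendsto_angleAt hΔt (hlim i).1 (hlim i).2
  exact ⟨h, ((SelfTriggered.continuous_boundaryPoint hQ hb ho).tendsto (θ i)).comp h⟩
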